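/- Let $\mathbb G$ be a step-$s$ Carnot group, i.e. a connected, simply connected real Lie group whose Lie algebra is $\mathfrak g=V_1\oplus\cdots\oplus V_s$ with $V_1,\dots,V_s\neq\{0\}$, $[V_1,V_i]=V_{i+1}$ for $1\le i<s$ and $[V_1,V_s]=\{0\}$. Fix a basis $X_1,\dots,X_N$ of $\mathfrak g$ adapted to the stratification (first a basis of $V_1$, then one of $V_2$, and so on), put $n=\dim V_1$, let $d_j$ be the index with $X_j\in V_{d_j}$, and identify $\mathbb G$ with $\mathbb R^N$ by $\exp(x_1X_1+\cdots+x_NX_N)\leftrightarrow(x_1,\dots,x_N)$; write $*$ for the group law on $\mathbb R^N$ so obtained. Let $d$ be any metric on $\mathbb G$ that is left-invariant, $d(p*x,p*y)=d(x,y)$, and homogeneous, $d(\delta_r x,\delta_r y)=r\,d(x,y)$ for all $r>0$, where $\delta_r(x)=(r^{d_1}x_1,\dots,r^{d_N}x_N)$. Let $\alpha\in(0,1]$ and let $\gamma=(\gamma_1,\dots,\gamma_N):[0,1]\to\mathbb R^N$ be of class $C^{1,\alpha}$, i.e. each $\gamma_j$ is differentiable on $[0,1]$ (one-sidedly at the endpoints)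 and $\gamma_j'$ is $\alpha$-Hölder continuous on $[0,1]$. Suppose also that $\gamma$ is Lipschitz as a map from $[0,1]$ into $(\mathbb G,d)$. For $t_0\in[0,1]$ set $$L_{t_0}(t)=\gamma(t_0)*\bigl((t-t_0)\gamma_1'(t_0),\dots,(t-t_0)\gamma_n'(t_0),0,\dots,0\bigr),\qquad t\in\mathbb R.$$ Then there is a constant $C>0$, depending on $\mathbb G$, $d$, $\alpha$ and $\gamma$ but not on $t_0$ or $t$, such that $$d(\gamma(t),L_{t_0}(t))\le C\,|t-t_0|^{1+\alpha/s}\qquad\text{for all } t_0,t\in[0,1].$$ -/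

import Mathlib

open Set
open scoped ContDiff Manifold

/-- The coordinate space `ℝ^N` with its Euclidean norm. -/
abbrev Coord (N : ℕ) : Type := EuclideanSpace ℝ (Fin N)

/-- The left-invariant vector field of a group law `mul` on `ℝ^N` (with identity `0`) that takes
the value `v` at the identity: `x ↦ d(L_x)_0 v`, where `L_x y = mul x y`. -/
noncomputable def leftInvField {N : ℕ} (mul : Coord N → Coord N → Coord N) (v : Coord N) :
    Coord N → Coord N :=
  fun x => fderiv ℝ (fun y => mul x y) 0 v

/-- The Lie bracket of the Lie algebra (the tangent space at the identity `0`) of a group law on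
`ℝ^N`: the value at `0` of the commutator of the left-invariant vector fields. -/
noncomputable def lieAlgBracket {N : ℕ} (mul : Coord N → Coord N → Coord N) (u v : Coord N) :
    Coord N :=
  VectorField.lieBracket ℝ (leftInvField mul u) (leftInvField mul v) 0

/-- The span of the standard basis vectors of degree `k`. -/
noncomputable def degreeLayer {N : ℕ} (deg : Fin N → ℕ) (k : ℕ) : Submodule ℝ (Coord N) :=
  Submodule.span ℝ ((fun j => EuclideanSpace.single j (1 : ℝ)) '' {j | deg j = k})

/-- A step-`s` Carnot group of dimension `N`, identified with `ℝ^N` by exponential coordinates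
`(x₁, …, x_N) ↔ exp (x₁ X₁ + ⋯ + x_N X_N)` with respect to a basis `X₁, …, X_N` of the Lie algebra
adapted to the stratification. The Lie algebra is the tangent space at the identity `0`, and `X_j`
is the `j`-th standard basis vector. No formula for the group law is part of the definition.
Being `ℝ^N` with its usual topology, the group is connected and simply connected. -/
structure CarnotGroup (N s : ℕ) where
  /-- The group law. -/
  mul : Coord N → Coord N → Coord N
  mul_assoc : ∀ x y z, mul (mul x y) z = mul x (mul y z)
  /-- The group law is smooth. -/
  smooth_mul : ContDiff ℝ ∞ (fun p : Coord N × Coord N => mul p.1 p.2)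
  /-- The coordinates are exponential: the one-parameter subgroup with velocity `x` at the
  identity, `t ↦ exp (t x)`, is the straight line `t ↦ t x`. In particular `0 = exp 0` is the
  identity and `-x` is the inverse of `x`; see below. -/
  mul_smul_smul : ∀ (a b : ℝ) (x : Coord N), mul (a • x) (b • x) = (a + b) • x
  /-- The degree of each coordinate; the `i`-th layer `V_i` of the Lie algebra is the span of the
  basis vectors of degree `i`. -/
  deg : Fin N → ℕ
  /-- The basis lists `V_1` first, then `V_2`, and so on. -/
  deg_mono : Monotone deg
  one_le_step : 1 ≤ s
  one_le_deg : ∀ j, 1 ≤ deg j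
  deg_le_step : ∀ j, deg j ≤ s
  /-- `V_1, …, V_s` are non-zero. -/
  layer_ne_bot : ∀ i, 1 ≤ i → i ≤ s → degreeLayer deg i ≠ ⊥
  /-- `[V_1, V_i] = V_{i+1}` for `i = 1, …, s - 1`. -/
  bracket_layer : ∀ i, 1 ≤ i → i < s →
    Submodule.span ℝ
      {w | ∃ u ∈ degreeLayer deg 1, ∃ v ∈ degreeLayer deg i, w = lieAlgBracket mul u v}
      = degreeLayer deg (i + 1)
  /-- `[V_1, V_s] = {0}`. -/
  bracket_last : ∀ u ∈ degreeLayer deg 1, ∀ v ∈ degreeLayer deg s, lieAlgBracket mul u v = 0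

namespace CarnotGroup

variable {N s : ℕ} (G : CarnotGroup N s)

theorem zero_mul (x : Coord N) : G.mul 0 x = x := by
  simpa using G.mul_smul_smul 0 1 x

theorem mul_zero (x : Coord N) : G.mul x 0 = x := by
  simpa using G.mul_smul_smul 1 0 x

theorem neg_mul_self (x : Coord N) : G.mul (-x) x = 0 := by
  simpa using G.mul_smul_smul (-1) 1 x

/-- The group structure on `ℝ^N`. -/
@[reducible] def group : Group (Coord N) where
  mul := G.mul
  mul_assoc := G.mul_assoc
  one := 0
  one_mul := G.zero_mul
  mul_one := G.mul_zero
  inv := fun x => -x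
  inv_mul_cancel := G.neg_mul_self

/-- With this group structure `ℝ^N` is a Lie group. -/
theorem lieGroup : letI := G.group; LieGroup 𝓘(ℝ, Coord N) ∞ (Coord N) :=
  letI := G.group
  { contMDiff_mul := by
      rw [← modelWithCornersSelf_prod, chartedSpaceSelf_prod]
      exact G.smooth_mul.contMDiff
    contMDiff_inv := (contDiff_neg (n := ∞) : ContDiff ℝ ∞ (fun x : Coord N => -x)).contMDiff }

/-- The dilation `δ_t (x) = (t^{deg 1} x₁, …, t^{deg N} x_N)`. -/
noncomputable def dilation (t : ℝ) (x : Coord N) : Coord N :=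
  WithLp.toLp 2 (fun j => t ^ G.deg j * x j)

/-- `d` is a left-invariant, homogeneous metric on the Carnot group. -/
structure IsHomogeneousMetric (d : Coord N → Coord N → ℝ) : Prop where
  eq_zero_iff : ∀ x y, d x y = 0 ↔ x = y
  symm : ∀ x y, d x y = d y x
  triangle : ∀ x y z, d x z ≤ d x y + d y z
  left_invariant : ∀ p x y, d (G.mul p x) (G.mul p y) = d x y
  homogeneous : ∀ t : ℝ, 0 < t → ∀ x y, d (G.dilation t x) (G.dilation t y) = t * d x y

/-- The horizontal vector `(γ₁'(t₀), …, γ_n'(t₀), 0, …, 0)` for a curve `γ` on `[a, b]`, where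
`1, …, n` are the coordinates of degree one (derivatives at the endpoints are one-sided). -/
noncomputable def horizontalVelocity (a b : ℝ) (γ : ℝ → Coord N) (t₀ : ℝ) : Coord N :=
  WithLp.toLp 2 (fun j =>
    if G.deg j = 1 then derivWithin (fun τ => γ τ j) (Icc a b) t₀ else 0)

/-- The horizontal tangent line
`L(t) = γ(t₀) * ((t - t₀) γ₁'(t₀), …, (t - t₀) γ_n'(t₀), 0, …, 0)` of a curve `γ` on `[a, b]`. -/
noncomputable def tangentLine (a b : ℝ) (γ : ℝ → Coord N) (t₀ t : ℝ) : Coord N :=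
  G.mul (γ t₀) ((t - t₀) • G.horizontalVelocity a b γ t₀)

end CarnotGroup

/-- `f : [a, b] → ℝ` is of class `C^{1,α}`: it is differentiable (one-sidedly at the endpoints) and
its derivative is `α`-Hölder continuous on `[a, b]`. -/
def IsC1Holder (α a b : ℝ) (f : ℝ → ℝ) : Prop :=
  DifferentiableOn ℝ f (Icc a b) ∧
    ∃ C : ℝ, ∀ x ∈ Icc a b, ∀ y ∈ Icc a b,
      |derivWithin f (Icc a b) x - derivWithin f (Icc a b) y| ≤ C * |x - y| ^ α

/-- `γ : [a, b] → ℝ^N` is of class `C^{1,α}`: each coordinate is. -/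
def IsC1HolderCurve {N : ℕ} (α a b : ℝ) (γ : ℝ → Coord N) : Prop :=
  ∀ j, IsC1Holder α a b (fun t => γ t j)

/-- `γ` is Lipschitz on `[a, b]` with respect to the metric `d`. -/
def IsLipschitzCurve {N : ℕ} (d : Coord N → Coord N → ℝ) (a b : ℝ) (γ : ℝ → Coord N) : Prop :=
  ∃ K : ℝ, ∀ x ∈ Icc a b, ∀ y ∈ Icc a b, d (γ x) (γ y) ≤ K * |x - y|

/-!
The proof is a blow-up argument. Fix `t₀`, put `e = t - t₀`, and rescale the increment of `γ` at
`t₀` by the dilation of factor `1/|e|`: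
`y(τ) = δ_{1/|e|} (γ(t₀)⁻¹ * γ(t₀ + τ e))` for `τ ∈ [0, 1]`.
Since `γ` is Lipschitz, `y` stays in a `d`-ball independent of `t₀` and `e`, hence in a Euclidean
ball. Since the coordinates of `γ(t)⁻¹ * γ(r)` of degree at least two are `O(|r - t|²)`, the left
logarithmic derivative of `γ` is its horizontal velocity `a`, so that `y` solves
`y' = X(y) (± a(t₀ + τ e))`, where `X` is the left-invariant frame. The tangent line becomes the
one-parameter subgroup `τ ↦ τ v`, `v = ± a(t₀)`, which solves `ℓ' = X(ℓ) v`. The two equations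
differ by `O(|e|^α)`, and Grönwall's inequality gives `‖v⁻¹ * y(1)‖ = O(|e|^α)`
(`exists_norm_neg_mul_le`). On bounded sets `d 0 x` is `O(‖x‖^{1/s})`; scaling back by `δ_{|e|}`
gives the exponent `1 + α/s`.

Two facts about Carnot groups carry this.

* Dilations are group automorphisms (`dilation_mul`). They preserve the bracket by the
  stratification and the Jacobi identity, and a linear map `φ` that preserves the bracket is an
  endomorphism of the group (`map_mul_of_map_bracket`): conjugation by `exp (t x)` is a linear map in exponential
  coordinates and solves the linear equation `u' = [x, u]`, hence commutes with `φ`; integrating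
  conjugations gives the differential of the exponential map, so `φ` also commutes with the
  left-invariant frame, and therefore with its integral curves `t ↦ p * (t y)`.
* A homogeneous metric is comparable to the Euclidean norm, although no continuity is assumed
  (`exists_le_rpow`, `exists_norm_le`). The vectors `g v g⁻¹` with `v ∈ V_1` span the Lie algebra,
  and `d 0` is bounded along short segments in their directions; products of such segments fill a
  neighbourhood of the identity by the inverse function theorem. Thus `d 0` is bounded near `0`,
  which by homogeneity improves to the bound `‖x‖^{1/s}` and to continuity; a positive minimum on
  the unit sphere then bounds the `d`-balls.
-/

namespace CarnotGroup

open Filter Topology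

variable {N s : ℕ} (G : CarnotGroup N s)

/-! ### Elementary group identities -/

theorem mul_neg_self (x : Coord N) : G.mul x (-x) = 0 := by
  simpa using G.neg_mul_self (-x)

theorem neg_mul_cancel_left (x y : Coord N) : G.mul (-x) (G.mul x y) = y := by
  rw [← G.mul_assoc, G.neg_mul_self, G.zero_mul]

theorem mul_neg_cancel_left (x y : Coord N) : G.mul x (G.mul (-x) y) = y := by
  rw [← G.mul_assoc, G.mul_neg_self, G.zero_mul]

theorem mul_neg_cancel_right (x y : Coord N) : G.mul (G.mul x y) (-y) = x := by
  rw [G.mul_assoc, G.mul_neg_self, G.mul_zero]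

theorem neg_mul_cancel_right (x y : Coord N) : G.mul (G.mul x (-y)) y = x := by
  rw [G.mul_assoc, G.neg_mul_self, G.mul_zero]

theorem mul_right_cancel {x y z : Coord N} (h : G.mul x z = G.mul y z) : x = y := by
  rw [← G.mul_neg_cancel_right x z, h, G.mul_neg_cancel_right]

theorem neg_mul_rev (x y : Coord N) : -(G.mul x y) = G.mul (-y) (-x) := by
  apply G.mul_right_cancel (z := G.mul x y)
  rw [G.neg_mul_self, G.mul_assoc, G.neg_mul_cancel_left, G.neg_mul_self]

theorem mul_self (x : Coord N) : G.mul x x = (2 : ℝ) • x := by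
  have := G.mul_smul_smul 1 1 x
  norm_num at this
  exact this

/-! ### Derivatives of the group law -/

/-- The total derivative of the group law. -/
noncomputable def dmul (p : Coord N × Coord N) : Coord N × Coord N →L[ℝ] Coord N :=
  fderiv ℝ (fun q : Coord N × Coord N => G.mul q.1 q.2) p

/-- The left-invariant frame: `G.frame p` maps `v` to the value at `p` of the left-invariant
vector field that equals `v` at the identity. -/
noncomputable def frame (p : Coord N) : Coord N →L[ℝ] Coord N :=
  fderiv ℝ (G.mul p) 0

theorem contDiff_mul {E : Type*} [NormedAddCommGroup E] [NormedSpace ℝ E] {f g : E → Coord N}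
    (hf : ContDiff ℝ ∞ f) (hg : ContDiff ℝ ∞ g) : ContDiff ℝ ∞ (fun x => G.mul (f x) (g x)) :=
  G.smooth_mul.comp (hf.prodMk hg)

theorem hasFDerivAt_mul (p : Coord N × Coord N) :
    HasFDerivAt (fun q : Coord N × Coord N => G.mul q.1 q.2) (G.dmul p) p :=
  (G.smooth_mul.differentiable (by simp) p).hasFDerivAt

theorem hasDerivWithinAt_mul {a b : ℝ → Coord N} {a' b' : Coord N} {S : Set ℝ} {t : ℝ}
    (ha : HasDerivWithinAt a a' S t) (hb : HasDerivWithinAt b b' S t) :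
    HasDerivWithinAt (fun t => G.mul (a t) (b t)) (G.dmul (a t, b t) (a', b')) S t :=
  HasFDerivAt.comp_hasDerivWithinAt (l := fun q : Coord N × Coord N => G.mul q.1 q.2)
    (f := fun t => (a t, b t)) t (G.hasFDerivAt_mul (a t, b t)) (ha.prodMk hb)

theorem hasDerivAt_mul {a b : ℝ → Coord N} {a' b' : Coord N} {t : ℝ}
    (ha : HasDerivAt a a' t) (hb : HasDerivAt b b' t) :
    HasDerivAt (fun t => G.mul (a t) (b t)) (G.dmul (a t, b t) (a', b')) t :=
  HasFDerivAt.comp_hasDerivAt (l := fun q : Coord N × Coord N => G.mul q.1 q.2)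
    (f := fun t => (a t, b t)) t (G.hasFDerivAt_mul (a t, b t)) (ha.prodMk hb)

theorem hasDerivAt_smul_const (v : Coord N) (t : ℝ) :
    HasDerivAt (fun t : ℝ => t • v) v t := by
  simpa using (hasDerivAt_id t).smul_const v

theorem contDiff_dmul : ContDiff ℝ ∞ G.dmul :=
  G.smooth_mul.fderiv_right (by simp)

theorem dmul_left (p q v : Coord N) :
    G.dmul (p, q) (0, v) = fderiv ℝ (G.mul p) q v := by
  have h : HasFDerivAt (G.mul p) ((G.dmul (p, q)).comp (.inr ℝ _ _)) q :=
    (G.hasFDerivAt_mul (p, q)).comp q (hasFDerivAt_prodMk_right p q)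
  rw [h.fderiv]; rfl

theorem frame_apply (p v : Coord N) : G.frame p v = G.dmul (p, 0) (0, v) :=
  (G.dmul_left p 0 v).symm

theorem dmul_zero_right (p a b : Coord N) : G.dmul (p, 0) (a, b) = a + G.frame p b := by
  have h : G.dmul (p, 0) (a, 0) = a := by
    have h1 : HasFDerivAt (fun x => G.mul x 0) ((G.dmul (p, 0)).comp (.inl ℝ _ _)) p :=
      HasFDerivAt.comp (g := fun q : Coord N × Coord N => G.mul q.1 q.2)
        (f := fun x => (x, (0 : Coord N))) p (G.hasFDerivAt_mul (p, 0))
        (hasFDerivAt_prodMk_left p 0)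
    simp only [G.mul_zero] at h1
    have := h1.unique (hasFDerivAt_id p)
    simpa using congrArg (fun L => L a) this
  rw [frame_apply, show ((a, b) : Coord N × Coord N) = (a, 0) + (0, b) by simp, map_add, h]

theorem frame_zero (v : Coord N) : G.frame 0 v = v := by
  have : G.mul 0 = id := funext G.zero_mul
  simp [frame, this]

theorem contDiff_fderiv_mul : ContDiff ℝ ∞ (fun p : Coord N × Coord N =>
    fderiv ℝ (G.mul p.1) p.2) := by
  refine ContDiff.fderiv (m := ∞) ?_ contDiff_snd (by simp)
  exact G.contDiff_mul (contDiff_fst.comp contDiff_fst) contDiff_snd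

theorem contDiff_frame : ContDiff ℝ ∞ G.frame :=
  G.contDiff_fderiv_mul.comp (contDiff_id.prodMk contDiff_const)

theorem differentiable_mul_left (p : Coord N) : Differentiable ℝ (G.mul p) :=
  (G.contDiff_mul contDiff_const contDiff_id).differentiable (by simp)

theorem hasDerivWithinAt_mul_left (p : Coord N) {b : ℝ → Coord N} {b' : Coord N} {S : Set ℝ}
    {t : ℝ} (hb : HasDerivWithinAt b b' S t) (h0 : b t = 0) :
    HasDerivWithinAt (fun t => G.mul p (b t)) (G.frame p b') S t := by
  have := G.hasDerivWithinAt_mul (hasDerivWithinAt_const t S p) hb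
  rwa [h0, ← frame_apply] at this

/-- A line through `p`, `t ↦ p * (t v)`, is an integral curve of the left-invariant field `v`. -/
theorem hasDerivAt_mul_smul (p v : Coord N) (t : ℝ) :
    HasDerivAt (fun t : ℝ => G.mul p (t • v)) (G.frame (G.mul p (t • v)) v) t := by
  have h0 : HasDerivAt (fun r : ℝ => (r - t) • v) v t := by
    simpa using ((hasDerivAt_id t).sub_const t).smul_const v
  have := G.hasDerivWithinAt_mul_left (G.mul p (t • v)) (S := univ) h0.hasDerivWithinAt (by simp)
  rw [hasDerivWithinAt_univ] at this
  refine this.congr_of_eventuallyEq (Eventually.of_forall fun r => ?_)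
  simp only [G.mul_assoc, G.mul_smul_smul, add_sub_cancel]

/-- The derivative of left translation by `-p` at `p`, which inverts the left-invariant frame. -/
noncomputable def coframe (p : Coord N) : Coord N →L[ℝ] Coord N :=
  fderiv ℝ (G.mul (-p)) p

theorem contDiff_coframe : ContDiff ℝ ∞ G.coframe :=
  G.contDiff_fderiv_mul.comp (contDiff_neg.prodMk contDiff_id)

theorem coframe_frame (p v : Coord N) : G.coframe p (G.frame p v) = v := by
  have h1 : HasFDerivAt (fun y => G.mul (-p) (G.mul p y)) ((G.coframe p).comp (G.frame p)) 0 := by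
    refine HasFDerivAt.comp (g := G.mul (-p)) 0 ?_ (G.differentiable_mul_left p 0).hasFDerivAt
    rw [G.mul_zero]
    exact (G.differentiable_mul_left (-p) p).hasFDerivAt
  simp only [G.neg_mul_cancel_left] at h1
  have := h1.unique (hasFDerivAt_id (0 : Coord N))
  exact congrArg (fun L => L v) this

theorem frame_coframe (p v : Coord N) : G.frame p (G.coframe p v) = v := by
  have h1 : HasFDerivAt (fun y => G.mul p (G.mul (-p) y)) ((G.frame p).comp (G.coframe p)) p := by
    refine HasFDerivAt.comp (g := G.mul p) p ?_ (G.differentiable_mul_left (-p) p).hasFDerivAt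
    rw [G.neg_mul_self]
    exact (G.differentiable_mul_left p 0).hasFDerivAt
  simp only [G.mul_neg_cancel_left] at h1
  have := h1.unique (hasFDerivAt_id p)
  exact congrArg (fun L => L v) this

theorem coframe_zero (v : Coord N) : G.coframe 0 v = v := by
  simpa [G.frame_zero] using G.coframe_frame 0 v

/-! ### Conjugation and the Lie bracket -/

/-- Conjugation `y ↦ g * y * g⁻¹`. -/
noncomputable def conj (g y : Coord N) : Coord N := G.mul (G.mul g y) (-g)

theorem contDiff_conj {E : Type*} [NormedAddCommGroup E] [NormedSpace ℝ E] {f g : E → Coord N}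
    (hf : ContDiff ℝ ∞ f) (hg : ContDiff ℝ ∞ g) : ContDiff ℝ ∞ (fun x => G.conj (f x) (g x)) :=
  G.contDiff_mul (G.contDiff_mul hf hg) hf.neg

theorem conj_mul (g x y : Coord N) : G.conj g (G.mul x y) = G.mul (G.conj g x) (G.conj g y) := by
  simp only [conj, G.mul_assoc, G.neg_mul_cancel_left]

theorem mul_conj (g h x : Coord N) : G.conj (G.mul g h) x = G.conj g (G.conj h x) := by
  simp only [conj, G.mul_assoc, G.neg_mul_rev]

theorem conj_zero_left (x : Coord N) : G.conj 0 x = x := by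
  simp [conj, G.mul_zero, G.zero_mul]

/-- In exponential coordinates an endomorphism of the group that is differentiable at the identity
is linear: it commutes with the squaring map `x ↦ 2 x`, hence equals its derivative. -/
theorem eq_fderiv_of_map_mul {c : Coord N → Coord N}
    (hc : ∀ x y, c (G.mul x y) = G.mul (c x) (c y)) (hd : DifferentiableAt ℝ c 0) (x : Coord N) :
    c x = fderiv ℝ c 0 x := by
  have h2 : ∀ x, c ((2 : ℝ) • x) = (2 : ℝ) • c x := fun x => by
    rw [← G.mul_self, hc, G.mul_self]
  have h0 : c 0 = 0 := by
    have := h2 0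
    rw [smul_zero, two_smul] at this
    exact (left_eq_add.mp this)
  have hn : ∀ n : ℕ, ((2 : ℝ) ^ n) • c (((2 : ℝ) ^ n)⁻¹ • x) = c x := by
    intro n
    induction n with
    | zero => simp
    | succ n ih =>
      rw [← ih, pow_succ, mul_smul, ← h2, smul_smul]
      congr 3
      field_simp
  have hlim := hd.hasFDerivAt.lim x (c := fun n : ℕ => (2 : ℝ) ^ n) (l := atTop) (by
    simp only [norm_pow, Real.norm_ofNat]
    exact tendsto_pow_atTop_atTop_of_one_lt one_lt_two)
  simp only [zero_add, h0, sub_zero, hn] at hlim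
  exact tendsto_nhds_unique tendsto_const_nhds hlim

/-- The adjoint representation. In exponential coordinates it coincides with conjugation. -/
noncomputable def Ad (g : Coord N) : Coord N →L[ℝ] Coord N := fderiv ℝ (G.conj g) 0

theorem conj_eq_Ad (g x : Coord N) : G.conj g x = G.Ad g x :=
  G.eq_fderiv_of_map_mul (G.conj_mul g)
    ((G.contDiff_conj contDiff_const contDiff_id).differentiable (by simp) 0) x

/-- The Lie bracket as a continuous bilinear map. -/
noncomputable def bracket : Coord N →L[ℝ] Coord N →L[ℝ] Coord N :=
  fderiv ℝ G.frame 0 - (fderiv ℝ G.frame 0).flip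

theorem hasFDerivAt_frame_apply (p v : Coord N) :
    HasFDerivAt (fun q => G.frame q v) ((fderiv ℝ G.frame p).flip v) p := by
  have h := (G.contDiff_frame.differentiable (by simp) p).hasFDerivAt
  exact (ContinuousLinearMap.apply ℝ (Coord N) v).hasFDerivAt.comp p h

theorem lieAlgBracket_eq (u v : Coord N) : lieAlgBracket G.mul u v = G.bracket u v := by
  have h : ∀ v, leftInvField G.mul v = fun q => G.frame q v := fun v => rfl
  simp only [lieAlgBracket, VectorField.lieBracket, h, (G.hasFDerivAt_frame_apply 0 _).fderiv,
    G.frame_zero, bracket]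
  simp

/-- The bracket is the derivative of the adjoint representation. Both mixed second derivatives of
the group law at the identity enter; they agree by symmetry of the second derivative. -/
theorem hasDerivAt_conj_smul_zero (x w : Coord N) :
    HasDerivAt (fun r : ℝ => G.conj (r • x) w) (G.bracket x w) 0 := by
  have hsm : ContDiff ℝ ∞ (fun r : ℝ => G.conj (r • x) w) :=
    G.contDiff_conj (contDiff_id.smul contDiff_const) contDiff_const
  have hu : HasDerivAt (fun r : ℝ => G.conj (r • x) w)
      (deriv (fun r : ℝ => G.conj (r • x) w) 0) 0 :=
    (hsm.differentiable (by simp) 0).hasDerivAt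
  set u' := deriv (fun r : ℝ => G.conj (r • x) w) 0
  -- Conjugation is linear in `w`, so its derivative in `r` scales with `e`; differentiating the
  -- product rule for `(r x) * (e w) * (r x)⁻¹` in `e` then yields the second derivatives.
  have key : ∀ e : ℝ, e • u' = G.dmul (0, e • w) (x, 0) - G.frame (e • w) x := by
    intro e
    have h1 : HasDerivAt (fun r : ℝ => G.conj (r • x) (e • w)) (e • u') 0 := by
      simp only [G.conj_eq_Ad, map_smul] at hu ⊢
      exact hu.const_smul e
    have hx := hasDerivAt_smul_const x 0
    have h2 := G.hasDerivAt_mul (G.hasDerivAt_mul hx (hasDerivAt_const (0 : ℝ) (e • w)))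
      hx.fun_neg
    have := h1.unique h2
    rw [this]
    simp only [zero_smul, neg_zero, G.zero_mul, G.dmul_zero_right, map_neg, sub_eq_add_neg]
  have hD : HasFDerivAt G.dmul (fderiv ℝ G.dmul 0) ((0 : Coord N), (0 : Coord N)) :=
    (G.contDiff_dmul.differentiable (by simp) 0).hasFDerivAt
  have hw := hasDerivAt_smul_const w 0
  have hL : HasDerivAt (fun e : ℝ => G.dmul (0, e • w)) (fderiv ℝ G.dmul 0 (0, w)) 0 := by
    refine HasFDerivAt.comp_hasDerivAt (l := G.dmul) (f := fun e : ℝ => ((0 : Coord N), e • w))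
      0 ?_ ((hasDerivAt_const (0 : ℝ) (0 : Coord N)).prodMk hw)
    simpa only [zero_smul] using hD
  have hL' : ∀ w : Coord N, HasDerivAt (fun e : ℝ => G.dmul (e • w, 0))
      (fderiv ℝ G.dmul 0 (w, 0)) 0 := by
    intro w
    refine HasFDerivAt.comp_hasDerivAt (l := G.dmul) (f := fun e : ℝ => (e • w, (0 : Coord N)))
      0 ?_ ((hasDerivAt_smul_const w 0).prodMk (hasDerivAt_const (0 : ℝ) (0 : Coord N)))
    simpa only [zero_smul] using hD
  have hL1 : HasDerivAt (fun e : ℝ => G.dmul (0, e • w) (x, 0))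
      (fderiv ℝ G.dmul 0 (0, w) (x, 0)) 0 := by
    simpa using hL.clm_apply (hasDerivAt_const (0 : ℝ) ((x, 0) : Coord N × Coord N))
  have hfr : ∀ w x : Coord N,
      HasDerivAt (fun e : ℝ => G.frame (e • w) x) (fderiv ℝ G.frame 0 w x) 0 := by
    intro w x
    refine HasFDerivAt.comp_hasDerivAt (l := fun q => G.frame q x) (f := fun e : ℝ => e • w)
      0 ?_ (hasDerivAt_smul_const w 0) (l' := (fderiv ℝ G.frame 0).flip x)
    simpa using G.hasFDerivAt_frame_apply 0 x
  have hR : ∀ w x : Coord N, fderiv ℝ G.frame 0 w x = fderiv ℝ G.dmul 0 (w, 0) (0, x) := by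
    intro w x
    refine (hfr w x).unique ?_
    simp only [frame_apply]
    simpa using (hL' w).clm_apply (hasDerivAt_const (0 : ℝ) ((0, x) : Coord N × Coord N))
  have hsymm : fderiv ℝ G.dmul 0 (0, w) (x, 0) = fderiv ℝ G.dmul 0 (x, 0) (0, w) :=
    (G.smooth_mul.contDiffAt (x := 0)).isSymmSndFDerivAt
      (by simpa using WithTop.coe_le_coe.2 (le_top (a := (2 : ℕ∞)))) (0, w) (x, 0)
  have hfin : HasDerivAt (fun e : ℝ => e • u') (G.bracket x w) 0 := by
    simp only [key]
    refine (hL1.sub (hfr w x)).congr_deriv ?_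
    rw [hsymm, ← hR]
    rfl
  have : u' = G.bracket x w := (hasDerivAt_smul_const u' 0).unique hfin
  rwa [this] at hu

theorem hasDerivAt_conj_smul (x w : Coord N) (t : ℝ) :
    HasDerivAt (fun r : ℝ => G.conj (r • x) w) (G.bracket x (G.conj (t • x) w)) t := by
  have h := G.hasDerivAt_conj_smul_zero x (G.conj (t • x) w)
  have h' : HasDerivAt (fun r : ℝ => G.conj ((r - t) • x) (G.conj (t • x) w))
      (G.bracket x (G.conj (t • x) w)) t := by
    have h0 : HasDerivAt (fun r : ℝ => r - t) 1 t := (hasDerivAt_id t).sub_const t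
    rw [← sub_self t] at h
    exact (HasDerivAt.scomp (h := fun r => r - t) t h h0).congr_deriv (one_smul _ _)
  refine h'.congr_of_eventuallyEq (Eventually.of_forall fun r => ?_)
  simp only [← G.mul_conj, G.mul_smul_smul, sub_add_cancel]

/-- Conjugation is a Lie algebra endomorphism. Its infinitesimal version is the Jacobi identity. -/
theorem conj_bracket (g x w : Coord N) :
    G.conj g (G.bracket x w) = G.bracket (G.conj g x) (G.conj g w) := by
  have h1 : HasDerivAt (fun r : ℝ => G.Ad g (G.conj (r • x) w)) (G.Ad g (G.bracket x w)) 0 :=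
    (G.Ad g).hasFDerivAt.comp_hasDerivAt 0 (G.hasDerivAt_conj_smul_zero x w)
  have h2 := G.hasDerivAt_conj_smul_zero (G.conj g x) (G.conj g w)
  rw [G.conj_eq_Ad, h1.unique (h2.congr_of_eventuallyEq (Eventually.of_forall fun r => ?_))]
  have h3 : r • G.conj g x = G.conj g (r • x) := by simp only [G.conj_eq_Ad, map_smul]
  have h4 : G.conj g (-(r • x)) = -G.conj g (r • x) := by simp only [G.conj_eq_Ad, map_neg]
  beta_reduce
  rw [h3, ← G.conj_eq_Ad, show G.conj (r • x) w = G.mul (G.mul (r • x) w) (-(r • x)) from rfl,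
    conj_mul, conj_mul, h4, ← conj]

theorem jacobi (z x w : Coord N) :
    G.bracket z (G.bracket x w) = G.bracket (G.bracket z x) w + G.bracket x (G.bracket z w) := by
  have h1 := G.hasDerivAt_conj_smul_zero z (G.bracket x w)
  simp only [conj_bracket] at h1
  have h2 := ((G.bracket.hasFDerivAt.comp_hasDerivAt 0 (G.hasDerivAt_conj_smul_zero z x))).clm_apply
    (G.hasDerivAt_conj_smul_zero z w)
  have := h1.unique h2
  simpa [G.conj_zero_left] using this

/-! ### Lie algebra endomorphisms are group endomorphisms -/

variable {G} in
/-- Both sides, with `x` replaced by `r x`, solve the linear equation `u' = [φ x, u]`. -/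
theorem map_conj_of_map_bracket {φ : Coord N →L[ℝ] Coord N}
    (hφ : ∀ x y, φ (G.bracket x y) = G.bracket (φ x) (φ y)) (x w : Coord N) :
    φ (G.conj x w) = G.conj (φ x) (φ w) := by
  have h := ODE_solution_unique_univ (v := fun _ : ℝ => G.bracket (φ x)) (s := fun _ => univ)
    (K := ‖G.bracket (φ x)‖₊) (t₀ := 0)
    (f := fun r : ℝ => φ (G.conj (r • x) w)) (g := fun r : ℝ => G.conj (r • φ x) (φ w))
    (fun t => (G.bracket (φ x)).lipschitz.lipschitzOnWith)
    (fun t => ⟨by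
      have := φ.hasFDerivAt.comp_hasDerivAt t (G.hasDerivAt_conj_smul x w t)
      rwa [hφ] at this, mem_univ _⟩)
    (fun t => ⟨G.hasDerivAt_conj_smul _ _ t, mem_univ _⟩)
    (by simp [G.conj_zero_left])
  simpa using congrFun h 1

/-- The integrated form of the formula for the differential of the exponential map:
`t ↦ t • coframe (t x) w` has derivative `Ad (exp (-t x)) w`. -/
theorem hasDerivAt_smul_coframe (x w : Coord N) (t : ℝ) :
    HasDerivAt (fun r : ℝ => r • G.coframe (r • x) w) (G.conj (-(t • x)) w) t := by
  -- The left logarithmic derivative of `e ↦ exp (r (x + e w))` at `e = 0`.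
  have hF : ∀ r : ℝ, HasDerivAt (fun e : ℝ => G.mul (-(r • x)) (r • (x + e • w)))
      (r • G.coframe (r • x) w) 0 := by
    intro r
    have h1 : HasDerivAt (fun e : ℝ => r • (x + e • w)) (r • w) 0 :=
      ((hasDerivAt_smul_const w 0).const_add x).const_smul r
    have h2 : HasFDerivAt (G.mul (-(r • x))) (G.coframe (r • x)) (r • (x + (0 : ℝ) • w)) := by
      simpa [coframe] using (G.differentiable_mul_left (-(r • x)) (r • x)).hasFDerivAt
    rw [← map_smul]
    exact h2.comp_hasDerivAt 0 h1
  have hadd : ∀ r : ℝ, r • G.coframe (r • x) w =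
      G.Ad (-(t • x)) ((r - t) • G.coframe ((r - t) • x) w) + t • G.coframe (t • x) w := by
    intro r
    have h1 := (G.Ad (-(t • x))).hasFDerivAt.comp_hasDerivAt 0 (hF (r - t))
    have h2 := G.hasDerivAt_mul h1 (hF t)
    refine (hF r).unique ?_
    simp only [Function.comp_def, zero_smul, add_zero, G.neg_mul_self, map_zero,
      G.dmul_zero_right, G.frame_zero] at h2
    refine h2.congr_of_eventuallyEq (Eventually.of_forall fun e => ?_)
    simp only [← G.conj_eq_Ad, conj, neg_neg, G.mul_assoc, G.mul_neg_cancel_left]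
    rw [G.mul_smul_smul, ← G.mul_assoc, ← neg_smul, ← neg_smul, ← neg_smul, G.mul_smul_smul]
    congr 2 <;> module
  have h0 : HasDerivAt (fun r : ℝ => r • G.coframe (r • x) w) w 0 := by
    have hd : DifferentiableAt ℝ (fun r : ℝ => G.coframe (r • x) w) 0 := by
      have : ContDiff ℝ ∞ (fun r : ℝ => G.coframe (r • x) w) :=
        (G.contDiff_coframe.comp (contDiff_id.smul contDiff_const)).clm_apply contDiff_const
      exact this.differentiable (by simp) 0
    refine ((hasDerivAt_id (0 : ℝ)).smul hd.hasDerivAt).congr_deriv ?_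
    simp [G.coframe_zero]
  have h1 : HasDerivAt (fun r : ℝ => (r - t) • G.coframe ((r - t) • x) w) w t := by
    rw [← sub_self t] at h0
    exact (HasDerivAt.scomp (h := fun r => r - t) t h0
      ((hasDerivAt_id t).sub_const t)).congr_deriv (one_smul _ _)
  rw [conj_eq_Ad]
  exact (((G.Ad (-(t • x))).hasFDerivAt.comp_hasDerivAt t h1).add_const _).congr_of_eventuallyEq
    (Eventually.of_forall hadd)

variable {G} in
theorem map_coframe_of_map_bracket {φ : Coord N →L[ℝ] Coord N}
    (hφ : ∀ x y, φ (G.bracket x y) = G.bracket (φ x) (φ y)) (x w : Coord N) :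
    φ (G.coframe x w) = G.coframe (φ x) (φ w) := by
  have hd : ∀ t : ℝ, HasDerivAt
      (fun r : ℝ => φ (r • G.coframe (r • x) w) - r • G.coframe (r • φ x) (φ w)) 0 t := by
    intro t
    have := (φ.hasFDerivAt.comp_hasDerivAt t (G.hasDerivAt_smul_coframe x w t)).sub
      (G.hasDerivAt_smul_coframe (φ x) (φ w) t)
    rw [map_conj_of_map_bracket hφ, map_neg, map_smul, sub_self] at this
    exact this
  have := is_const_of_deriv_eq_zero (fun t => (hd t).differentiableAt) (fun t => (hd t).deriv) 1 0
  simpa [sub_eq_zero] using this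

variable {G} in
theorem map_frame_of_map_bracket {φ : Coord N →L[ℝ] Coord N}
    (hφ : ∀ x y, φ (G.bracket x y) = G.bracket (φ x) (φ y)) (x w : Coord N) :
    φ (G.frame x w) = G.frame (φ x) (φ w) := by
  have := map_coframe_of_map_bracket hφ x (G.frame x w)
  rw [G.coframe_frame] at this
  rw [this, G.frame_coframe]

variable {G} in
/-- A linear map that preserves the bracket is an endomorphism of the group. -/
theorem map_mul_of_map_bracket {φ : Coord N →L[ℝ] Coord N}
    (hφ : ∀ x y, φ (G.bracket x y) = G.bracket (φ x) (φ y)) (x y : Coord N) :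
    φ (G.mul x y) = G.mul (φ x) (φ y) := by
  -- `t ↦ φ (x * t y) * (t φ y)⁻¹` is constant, since `t ↦ φ (x * t y)` is an integral curve of
  -- the left-invariant field `φ y`, exactly as `t ↦ p * t φ y`.
  have hd : ∀ t : ℝ, HasDerivAt (fun r : ℝ => G.mul (φ (G.mul x (r • y))) (-(r • φ y))) 0 t := by
    intro t
    have hn := (hasDerivAt_smul_const (φ y) t).fun_neg
    have h1 := G.hasDerivAt_mul (φ.hasFDerivAt.comp_hasDerivAt t (G.hasDerivAt_mul_smul x y t)) hn
    set p := G.mul (φ (G.mul x (t • y))) (-(t • φ y)) with hp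
    have h2 := G.hasDerivAt_mul (G.hasDerivAt_mul_smul p (φ y) t) hn
    simp only [hp, G.neg_mul_cancel_right, G.mul_neg_cancel_right] at h2
    rw [map_frame_of_map_bracket hφ] at h1
    have h3 := h2.unique (hasDerivAt_const t _)
    rw [← h3]
    exact h1
  have := is_const_of_deriv_eq_zero (fun t => (hd t).differentiableAt) (fun t => (hd t).deriv) 1 0
  simp only [one_smul, zero_smul, neg_zero, G.mul_zero] at this
  rw [← this, G.neg_mul_cancel_right]

/-! ### Generation by the first layer, and dilations -/

theorem single_mem_degreeLayer (j : Fin N) :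
    EuclideanSpace.single j (1 : ℝ) ∈ degreeLayer G.deg (G.deg j) :=
  Submodule.subset_span ⟨j, rfl, rfl⟩

theorem sum_smul_single (x : Coord N) : ∑ j, x j • EuclideanSpace.single j (1 : ℝ) = x := by
  ext i
  simp [Pi.single_apply]

/-- The first layer generates: a subspace that contains `V_1` and is stable under bracketing with
`V_1` is the whole Lie algebra. -/
theorem mem_of_degreeLayer_one_le {S : Submodule ℝ (Coord N)} (h1 : degreeLayer G.deg 1 ≤ S)
    (hS : ∀ u ∈ degreeLayer G.deg 1, ∀ v ∈ S, G.bracket u v ∈ S) (x : Coord N) : x ∈ S := by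
  have hlayer : ∀ i, 1 ≤ i → i ≤ s → degreeLayer G.deg i ≤ S := by
    intro i hi
    induction i, hi using Nat.le_induction with
    | base => exact fun _ => h1
    | succ i hi ih =>
      intro his
      rw [← G.bracket_layer i hi (by omega), Submodule.span_le]
      rintro w ⟨u, hu, v, hv, rfl⟩
      rw [lieAlgBracket_eq]
      exact hS u hu v (ih (by omega) hv)
  rw [← sum_smul_single x]
  exact S.sum_mem fun j _ => S.smul_mem _
    (hlayer _ (G.one_le_deg j) (G.deg_le_step j) (G.single_mem_degreeLayer j))

@[simp]
theorem dilation_apply (r : ℝ) (x : Coord N) (j : Fin N) :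
    G.dilation r x j = r ^ G.deg j * x j := rfl

/-- The dilation as a continuous linear map. -/
noncomputable def dilationCLM (r : ℝ) : Coord N →L[ℝ] Coord N :=
  LinearMap.toContinuousLinearMap
    { toFun := G.dilation r
      map_add' := fun x y => by ext j; simp [mul_add]
      map_smul' := fun c x => by ext j; simp; ring }

@[simp]
theorem dilationCLM_apply (r : ℝ) (x : Coord N) : G.dilationCLM r x = G.dilation r x := rfl

theorem dilation_of_mem {k : ℕ} {x : Coord N} (hx : x ∈ degreeLayer G.deg k) (r : ℝ) :
    G.dilation r x = r ^ k • x := by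
  suffices h : degreeLayer G.deg k ≤
      LinearMap.eqLocus (G.dilationCLM r : Coord N →ₗ[ℝ] Coord N) (r ^ k • LinearMap.id) from h hx
  rw [degreeLayer, Submodule.span_le]
  rintro _ ⟨j, hj, rfl⟩
  ext i
  simp only [mem_ofPred_eq] at hj
  by_cases hij : i = j
  · subst hij; simp [hj]
  · simp [hij]

/-- Dilations preserve the bracket. The definition of the layers gives this when the first argument
lies in `V_1`; the Jacobi identity makes the set of good first arguments stable under bracketing. -/
theorem dilation_bracket (r : ℝ) (x y : Coord N) :
    G.dilationCLM r (G.bracket x y) = G.bracket (G.dilationCLM r x) (G.dilationCLM r y) := by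
  let S : Submodule ℝ (Coord N) :=
    { carrier := {x | ∀ y, G.dilationCLM r (G.bracket x y) =
        G.bracket (G.dilationCLM r x) (G.dilationCLM r y)}
      zero_mem' := fun y => by simp only [map_zero, zero_apply]
      add_mem' := fun {a b} ha hb y => by
        simp only [map_add, add_apply, ha y, hb y]
      smul_mem' := fun c a ha y => by
        simp only [map_smul, smul_apply, ha y] }
  have h1 : degreeLayer G.deg 1 ≤ S := by
    intro u hu y
    have hj : ∀ j, G.dilation r (G.bracket u (EuclideanSpace.single j 1)) =
        G.bracket (G.dilation r u) (G.dilation r (EuclideanSpace.single j 1)) := by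
      intro j
      have hmem := G.single_mem_degreeLayer j
      rw [G.dilation_of_mem hu, G.dilation_of_mem hmem, map_smul, map_smul,
        smul_apply, smul_smul, ← pow_add]
      rcases (G.deg_le_step j).lt_or_eq with h | h
      · refine G.dilation_of_mem ?_ r
        rw [← G.bracket_layer _ (G.one_le_deg j) h]
        exact Submodule.subset_span ⟨u, hu, _, hmem, (G.lieAlgBracket_eq _ _).symm⟩
      · rw [h] at hmem
        have h0 := G.bracket_last u hu _ hmem
        rw [G.lieAlgBracket_eq] at h0
        rw [h0, smul_zero, ← dilationCLM_apply, map_zero]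
    rw [← sum_smul_single y]
    simp only [map_sum, map_smul, dilationCLM_apply, hj]
  refine G.mem_of_degreeLayer_one_le (S := S) h1 (fun u hu v hv y => ?_) x y
  have hu := h1 hu
  have e : ∀ u v y, G.bracket (G.bracket u v) y =
      G.bracket u (G.bracket v y) - G.bracket v (G.bracket u y) := fun u v y => by
    rw [G.jacobi u v y, add_sub_cancel_right]
  rw [e, map_sub, hu, hv, hv, hu, hu, e]

theorem dilation_mul (r : ℝ) (x y : Coord N) :
    G.dilation r (G.mul x y) = G.mul (G.dilation r x) (G.dilation r y) :=
  map_mul_of_map_bracket (G.dilation_bracket r) x y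

theorem dilation_smul (r c : ℝ) (x : Coord N) :
    G.dilation r (c • x) = c • G.dilation r x := (G.dilationCLM r).map_smul c x

theorem dilation_neg (r : ℝ) (x : Coord N) : G.dilation r (-x) = -G.dilation r x :=
  (G.dilationCLM r).map_neg x

theorem dilation_zero (r : ℝ) : G.dilation r 0 = 0 := (G.dilationCLM r).map_zero

theorem dilation_dilation (r t : ℝ) (x : Coord N) :
    G.dilation r (G.dilation t x) = G.dilation (r * t) x := by
  ext j; simp [mul_pow]; ring

theorem dilation_one (x : Coord N) : G.dilation 1 x = x := by
  ext j; simp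

theorem dilation_dilation_inv {r : ℝ} (hr : r ≠ 0) (x : Coord N) :
    G.dilation r (G.dilation r⁻¹ x) = x := by
  rw [dilation_dilation, mul_inv_cancel₀ hr, dilation_one]

theorem mem_degreeLayer_one_of {x : Coord N} (hx : ∀ j, G.deg j ≠ 1 → x j = 0) :
    x ∈ degreeLayer G.deg 1 := by
  rw [← sum_smul_single x]
  refine Submodule.sum_mem _ fun j _ => ?_
  by_cases hj : G.deg j = 1
  · exact Submodule.smul_mem _ _ (hj ▸ G.single_mem_degreeLayer j)
  · rw [hx j hj, zero_smul]; exact Submodule.zero_mem _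

theorem continuous_dilation (x : Coord N) : Continuous (fun r => G.dilation r x) := by
  have : Continuous (fun r : ℝ => fun j => r ^ G.deg j * x j) := by fun_prop
  exact (PiLp.continuous_toLp 2 _).comp this

theorem hasDerivWithinAt_iff_forall_coord {f : ℝ → Coord N} {f' : Coord N} {S : Set ℝ} {t : ℝ} :
    HasDerivWithinAt f f' S t ↔ ∀ j, HasDerivWithinAt (fun r => f r j) (f' j) S t := by
  rw [hasDerivWithinAt_iff_hasFDerivWithinAt, hasFDerivWithinAt_euclidean]
  refine forall_congr' fun j => ?_
  rw [hasDerivWithinAt_iff_hasFDerivWithinAt]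
  refine iff_of_eq ?_
  congr 1

/-- The coordinates of degree one are additive characters of the group: the derivative at `r = 0`
of the identity `δ_r (x * y) = δ_r x * δ_r y` only sees these coordinates. -/
theorem mul_apply_of_deg_eq_one {j : Fin N} (hj : G.deg j = 1) (x y : Coord N) :
    G.mul x y j = x j + y j := by
  have hd : ∀ x : Coord N, HasDerivAt (fun r => G.dilation r x)
      (WithLp.toLp 2 fun j => if G.deg j = 1 then x j else 0) 0 := by
    intro x
    rw [← hasDerivWithinAt_univ, hasDerivWithinAt_iff_forall_coord]
    intro i
    rw [hasDerivWithinAt_univ]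
    have h : HasDerivAt (fun r : ℝ => r ^ G.deg i * x i) _ 0 :=
      (hasDerivAt_pow (G.deg i) (0 : ℝ)).mul_const (x i)
    refine h.congr_deriv ?_
    have := G.one_le_deg i
    by_cases hi : G.deg i = 1
    · simp [hi]
    · simp [hi, show G.deg i - 1 ≠ 0 by omega]
  have h1 := G.hasDerivAt_mul (hd x) (hd y)
  have h0 : ∀ x, G.dilation 0 x = 0 := fun x => by
    ext i; have := G.one_le_deg i; simp [show G.deg i ≠ 0 by omega]
  simp only [← G.dilation_mul, h0, G.dmul_zero_right, G.frame_zero] at h1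
  simpa [hj] using congrArg (fun v : Coord N => v j) ((hd (G.mul x y)).unique h1)

theorem norm_le_mul_norm {x y : Coord N} {c : ℝ} (hc : 0 ≤ c) (h : ∀ j, |x j| ≤ c * |y j|) :
    ‖x‖ ≤ c * ‖y‖ := by
  rw [EuclideanSpace.norm_eq, EuclideanSpace.norm_eq, ← Real.sqrt_sq hc,
    ← Real.sqrt_mul (sq_nonneg c), Finset.mul_sum]
  refine Real.sqrt_le_sqrt (Finset.sum_le_sum fun j _ => ?_)
  rw [← mul_pow]
  exact pow_le_pow_left₀ (norm_nonneg _) (h j) 2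

theorem norm_dilation_le {r : ℝ} (h0 : 0 ≤ r) (h1 : r ≤ 1) (x : Coord N) :
    ‖G.dilation r x‖ ≤ r * ‖x‖ := by
  refine norm_le_mul_norm h0 fun j => ?_
  rw [dilation_apply, abs_mul, abs_of_nonneg (pow_nonneg h0 _)]
  gcongr
  exact pow_le_of_le_one h0 h1 (by have := G.one_le_deg j; omega)

theorem norm_dilation_le_pow {r : ℝ} (h1 : 1 ≤ r) (x : Coord N) :
    ‖G.dilation r x‖ ≤ r ^ s * ‖x‖ := by
  have h0 : 0 ≤ r := by linarith
  refine norm_le_mul_norm (by positivity) fun j => ?_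
  rw [dilation_apply, abs_mul, abs_of_nonneg (pow_nonneg h0 _)]
  gcongr
  exact G.deg_le_step j

/-! ### Homogeneous metrics and the Euclidean norm -/

variable {G} {d : Coord N → Coord N → ℝ}

theorem IsHomogeneousMetric.nonneg (hd : G.IsHomogeneousMetric d) (x y : Coord N) : 0 ≤ d x y := by
  have h1 := hd.triangle x y x
  rw [(hd.eq_zero_iff x x).2 rfl, hd.symm y x] at h1
  linarith

theorem IsHomogeneousMetric.eq_zero_neg_mul (hd : G.IsHomogeneousMetric d) (x y : Coord N) :
    d x y = d 0 (G.mul (-x) y) := by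
  rw [← hd.left_invariant (-x) x y, G.neg_mul_self]

theorem IsHomogeneousMetric.zero_neg (hd : G.IsHomogeneousMetric d) (x : Coord N) :
    d 0 (-x) = d 0 x := by
  rw [← hd.left_invariant x, G.mul_zero, G.mul_neg_self, hd.symm]

theorem IsHomogeneousMetric.zero_mul_le (hd : G.IsHomogeneousMetric d) (x y : Coord N) :
    d 0 (G.mul x y) ≤ d 0 x + d 0 y := by
  have := hd.triangle 0 x (G.mul x y)
  rwa [hd.eq_zero_neg_mul x, G.neg_mul_cancel_left] at this

theorem IsHomogeneousMetric.zero_conj_le (hd : G.IsHomogeneousMetric d) (g x : Coord N) :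
    d 0 (G.conj g x) ≤ 2 * d 0 g + d 0 x := by
  have h1 := hd.zero_mul_le (G.mul g x) (-g)
  have h2 := hd.zero_mul_le g x
  rw [hd.zero_neg] at h1
  rw [conj]
  linarith

theorem IsHomogeneousMetric.zero_dilation (hd : G.IsHomogeneousMetric d) {t : ℝ} (ht : 0 < t)
    (x : Coord N) : d 0 (G.dilation t x) = t * d 0 x := by
  have := hd.homogeneous t ht 0 x
  rwa [G.dilation_zero] at this

theorem IsHomogeneousMetric.zero_smul_of_mem (hd : G.IsHomogeneousMetric d) {v : Coord N}
    (hv : v ∈ degreeLayer G.deg 1) (t : ℝ) : d 0 (t • v) = |t| * d 0 v := by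
  have hpos : ∀ t : ℝ, 0 < t → d 0 (t • v) = t * d 0 v := fun t ht => by
    rw [← hd.zero_dilation ht, G.dilation_of_mem hv, pow_one]
  rcases lt_trichotomy t 0 with h | rfl | h
  · rw [← hd.zero_neg, ← neg_smul, hpos _ (by linarith), abs_of_neg h]
  · simp [(hd.eq_zero_iff 0 0).2 rfl]
  · rw [hpos t h, abs_of_pos h]

/-- A linear map `L` has a bounded lift if it is the strict derivative at `0` of a map that fixes
`0` and stays at bounded `d`-distance from `0` near `0`. Nothing relates `d` to the topology yet:
the lift of the identity map will give the first such relation. -/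
def HasBoundedLift (d : Coord N → Coord N → ℝ) (L : Coord N →L[ℝ] Coord N) : Prop :=
  ∃ F : Coord N → Coord N, HasStrictFDerivAt F L 0 ∧ F 0 = 0 ∧ ∃ C, ∀ᶠ x in 𝓝 0, d 0 (F x) ≤ C

theorem hasBoundedLift_zero (d : Coord N → Coord N → ℝ) : HasBoundedLift d 0 :=
  ⟨fun _ => 0, hasStrictFDerivAt_const 0 0, rfl, d 0 0, Eventually.of_forall fun _ => le_rfl⟩

/-- The product of two lifts lifts the sum. -/
theorem HasBoundedLift.add (hd : G.IsHomogeneousMetric d) {L M : Coord N →L[ℝ] Coord N}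
    (hL : HasBoundedLift d L) (hM : HasBoundedLift d M) : HasBoundedLift d (L + M) := by
  obtain ⟨F, hF, hF0, A, hA⟩ := hL
  obtain ⟨H, hH, hH0, B, hB⟩ := hM
  refine ⟨fun x => G.mul (F x) (H x), ?_, by simp only [hF0, hH0, G.mul_zero], A + B, ?_⟩
  · have hm : HasStrictFDerivAt (fun q : Coord N × Coord N => G.mul q.1 q.2) (G.dmul 0)
        (F 0, H 0) := by
      rw [hF0, hH0]
      exact G.smooth_mul.contDiffAt.hasStrictFDerivAt' (G.hasFDerivAt_mul 0) (by simp)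
    have := HasStrictFDerivAt.comp (g := fun q : Coord N × Coord N => G.mul q.1 q.2)
      (f := fun x => (F x, H x)) 0 hm (hF.prodMk hH)
    refine this.congr_fderiv ?_
    ext1 v
    change G.dmul (0, 0) (L v, M v) = L v + M v
    rw [G.dmul_zero_right, G.frame_zero]
  · filter_upwards [hA, hB] with x hx hx'
    exact (hd.zero_mul_le _ _).trans (add_le_add hx hx')

theorem HasBoundedLift.conj (hd : G.IsHomogeneousMetric d) {L : Coord N →L[ℝ] Coord N}
    (hL : HasBoundedLift d L) (g : Coord N) : HasBoundedLift d ((G.Ad g).comp L) := by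
  obtain ⟨F, hF, hF0, A, hA⟩ := hL
  refine ⟨fun x => G.Ad g (F x), (G.Ad g).hasStrictFDerivAt.comp 0 hF, by simp [hF0],
    2 * d 0 g + A, ?_⟩
  filter_upwards [hA] with x hx
  have := hd.zero_conj_le g (F x)
  rw [G.conj_eq_Ad] at this
  linarith

theorem hasBoundedLift_smulRight_of_mem (hd : G.IsHomogeneousMetric d) {v : Coord N}
    (hv : v ∈ degreeLayer G.deg 1) (l : Coord N →L[ℝ] ℝ) : HasBoundedLift d (l.smulRight v) := by
  refine ⟨l.smulRight v, (l.smulRight v).hasStrictFDerivAt, by simp, d 0 v, ?_⟩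
  have : Tendsto (fun x => |l x|) (𝓝 0) (𝓝 0) := by
    have : Continuous (fun x => |l x|) := by fun_prop
    simpa using this.tendsto 0
  filter_upwards [this.eventually_le_const one_pos] with x hx
  rw [ContinuousLinearMap.smulRight_apply, hd.zero_smul_of_mem hv]
  exact mul_le_of_le_one_left (hd.nonneg _ _) hx

/-- Every linear map of rank one has a bounded lift. The vectors `w` with this property for all
maps with range in `ℝ w` form a subspace that contains `V_1` and is stable under conjugation, hence
under bracketing. -/
theorem hasBoundedLift_smulRight (hd : G.IsHomogeneousMetric d) (w : Coord N)
    (l : Coord N →L[ℝ] ℝ) : HasBoundedLift d (l.smulRight w) := by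
  let S : Submodule ℝ (Coord N) :=
    { carrier := {w | ∀ l : Coord N →L[ℝ] ℝ, HasBoundedLift d (l.smulRight w)}
      zero_mem' := fun l => by
        have : l.smulRight (0 : Coord N) = 0 := by ext1; simp
        rw [this]; exact hasBoundedLift_zero d
      add_mem' := fun {a b} ha hb l => by
        have : l.smulRight (a + b) = l.smulRight a + l.smulRight b := by ext1; simp
        rw [this]; exact (ha l).add hd (hb l)
      smul_mem' := fun c a ha l => by
        have : l.smulRight (c • a) = (c • l).smulRight a := by ext1; simp [smul_smul, mul_comm]
        rw [this]; exact ha _ }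
  refine G.mem_of_degreeLayer_one_le (S := S)
    (fun v hv l => hasBoundedLift_smulRight_of_mem hd hv l)
    (fun u _ v hv => ?_) w l
  have hconj : ∀ g, G.conj g v ∈ S := fun g l => by
    have : l.smulRight (G.conj g v) = (G.Ad g).comp (l.smulRight v) := by
      ext1; simp [G.conj_eq_Ad]
    rw [this]; exact (hv l).conj hd g
  have hslope := (hasDerivAt_iff_tendsto_slope.1 (G.hasDerivAt_conj_smul_zero u v))
  refine S.closed_of_finiteDimensional.mem_of_tendsto hslope (Eventually.of_forall fun r => ?_)
  exact S.smul_mem _ (S.sub_mem (hconj _) (hconj _))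

/-- Points near `0` are at bounded `d`-distance from `0`. -/
theorem IsHomogeneousMetric.eventually_le (hd : G.IsHomogeneousMetric d) :
    ∃ C, ∀ᶠ x in 𝓝 0, d 0 x ≤ C := by
  have hid : HasBoundedLift d (ContinuousLinearMap.id ℝ (Coord N)) := by
    have hsum : ∀ T : Finset (Fin N), HasBoundedLift d (∑ j ∈ T,
        (EuclideanSpace.proj j : Coord N →L[ℝ] ℝ).smulRight (EuclideanSpace.single j (1 : ℝ))) := by
      classical
      intro T
      induction T using Finset.induction_on with
      | empty => simpa using hasBoundedLift_zero d
      | insert j T hj ih =>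
        rw [Finset.sum_insert hj]
        exact (hasBoundedLift_smulRight hd _ _).add hd ih
    convert hsum Finset.univ using 1
    ext1 x
    simpa using (sum_smul_single x).symm
  obtain ⟨F, hF, hF0, C, hC⟩ := hid
  have hmap := HasStrictFDerivAt.map_nhds_eq_of_equiv
    (f' := ContinuousLinearEquiv.refl ℝ (Coord N)) hF
  rw [hF0] at hmap
  exact ⟨C, hmap ▸ hC⟩

/-- Contracting a Euclidean ball into a neighbourhood of `0` costs a bounded factor. -/
theorem IsHomogeneousMetric.exists_le_of_norm_le (hd : G.IsHomogeneousMetric d) (R : ℝ) :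
    ∃ C, 0 ≤ C ∧ ∀ x, ‖x‖ ≤ R → d 0 x ≤ C := by
  obtain ⟨C, hC⟩ := hd.eventually_le
  obtain ⟨ρ, hρ, hC⟩ := Metric.eventually_nhds_iff.1 hC
  set r := min 1 (ρ / (2 * (|R| + 1))) with hr
  have hr0 : 0 < r := by positivity
  have hC0 : 0 ≤ C := (hd.nonneg 0 0).trans (hC (by simpa using hρ))
  refine ⟨r⁻¹ * C, by positivity, fun x hx => ?_⟩
  have h1 : d 0 (G.dilation r x) ≤ C := by
    refine hC ?_
    rw [dist_zero_right]
    have h2 : r * ‖x‖ ≤ ρ / (2 * (|R| + 1)) * (|R| + 1) := by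
      gcongr
      · exact min_le_right _ _
      · linarith [le_abs_self R]
    have h3 : ρ / (2 * (|R| + 1)) * (|R| + 1) = ρ / 2 := by
      have : |R| + 1 ≠ 0 := by positivity
      field_simp
    linarith [G.norm_dilation_le hr0.le (min_le_left _ _) x]
  rw [hd.zero_dilation hr0] at h1
  rwa [inv_mul_eq_div, le_div_iff₀' hr0]

/-- Upper comparison: on Euclidean balls `d 0 x` is at most a multiple of `‖x‖ ^ (1 / s)`. -/
theorem IsHomogeneousMetric.exists_le_rpow (hd : G.IsHomogeneousMetric d) {R : ℝ} (hR : 0 < R) :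
    ∃ C, 0 ≤ C ∧ ∀ x, ‖x‖ ≤ R → d 0 x ≤ C * ‖x‖ ^ (1 / (s : ℝ)) := by
  obtain ⟨C, hC0, hC⟩ := hd.exists_le_of_norm_le R
  have hs : (s : ℝ) ≠ 0 := by have := G.one_le_step; positivity
  refine ⟨C / R ^ (1 / (s : ℝ)), by positivity, fun x hx => ?_⟩
  rcases eq_or_ne x 0 with rfl | hx0
  · rw [(hd.eq_zero_iff 0 0).2 rfl]; positivity
  have hxpos : 0 < ‖x‖ := norm_pos_iff.2 hx0
  set r : ℝ := (‖x‖ / R) ^ (1 / (s : ℝ)) with hr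
  have hr0 : 0 < r := by positivity
  have hr1 : r ≤ 1 := Real.rpow_le_one (by positivity) ((div_le_one hR).2 hx) (by positivity)
  have hrs : r ^ s = ‖x‖ / R := by
    rw [hr, ← Real.rpow_natCast, ← Real.rpow_mul (by positivity), one_div_mul_cancel hs,
      Real.rpow_one]
  have hy : ‖G.dilation r⁻¹ x‖ ≤ R := by
    refine (G.norm_dilation_le_pow ((one_le_inv₀ hr0).2 hr1) x).trans_eq ?_
    rw [inv_pow, hrs]
    field_simp
  rw [← G.dilation_dilation_inv hr0.ne' x, hd.zero_dilation hr0, G.dilation_dilation_inv hr0.ne' x]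
  calc r * d 0 (G.dilation r⁻¹ x) ≤ r * C := by gcongr; exact hC _ hy
    _ = _ := by rw [hr, Real.div_rpow hxpos.le hR.le]; ring

/-- Continuity of `d 0` for the Euclidean topology is a consequence of homogeneity. -/
theorem IsHomogeneousMetric.continuous (hd : G.IsHomogeneousMetric d) : Continuous (d 0) := by
  rw [continuous_iff_continuousAt]
  intro x
  obtain ⟨C, -, hC⟩ := hd.exists_le_rpow one_pos
  have hs : 0 < 1 / (s : ℝ) := by have := G.one_le_step; positivity
  have hcont : Tendsto (fun y => ‖G.mul (-x) y‖) (𝓝 x) (𝓝 0) := by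
    have := ((G.differentiable_mul_left (-x)).continuous.norm).tendsto x
    rwa [G.neg_mul_self, norm_zero] at this
  have hlim : Tendsto (fun y => C * ‖G.mul (-x) y‖ ^ (1 / (s : ℝ))) (𝓝 x) (𝓝 0) := by
    have := (hcont.rpow_const (Or.inr hs.le)).const_mul C
    rwa [Real.zero_rpow hs.ne', MulZeroClass.mul_zero] at this
  refine tendsto_iff_norm_sub_tendsto_zero.2 (squeeze_zero' (Eventually.of_forall fun _ =>
    norm_nonneg _) ?_ hlim)
  filter_upwards [hcont.eventually_le_const one_pos] with y hy
  refine le_trans ?_ (hC _ hy)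
  rw [← hd.eq_zero_neg_mul, Real.norm_eq_abs, abs_sub_le_iff]
  have h1 := hd.triangle 0 x y
  have h2 := hd.triangle 0 y x
  rw [hd.symm y x] at h2
  constructor <;> linarith

/-- Lower comparison: `d`-balls are bounded for the Euclidean norm. -/
theorem IsHomogeneousMetric.exists_norm_le (hd : G.IsHomogeneousMetric d) (K : ℝ) :
    ∃ R, 0 < R ∧ ∀ x, d 0 x ≤ K → ‖x‖ ≤ R := by
  obtain ⟨c, hc, hsphere⟩ : ∃ c, 0 < c ∧ ∀ x : Coord N, ‖x‖ = 1 → c ≤ d 0 x := by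
    rcases (Metric.sphere (0 : Coord N) 1).eq_empty_or_nonempty with he | hne
    · refine ⟨1, one_pos, fun x hx => ?_⟩
      have : x ∈ Metric.sphere (0 : Coord N) 1 := by simpa using hx
      simp [he] at this
    · obtain ⟨z, hz, hmin⟩ := (isCompact_sphere (0 : Coord N) 1).exists_isMinOn hne
        hd.continuous.continuousOn
      refine ⟨d 0 z, lt_of_le_of_ne (hd.nonneg _ _) fun h => ?_,
        fun x hx => hmin (by simpa using hx)⟩
      rw [← (hd.eq_zero_iff 0 z).1 h.symm] at hz
      simp at hz
  -- Some dilation of factor `r ≤ 1` moves a point outside the unit ball onto the unit sphere.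
  have hball : ∀ x, d 0 x < c → ‖x‖ ≤ 1 := by
    intro x hx
    by_contra! h
    have h0 : ‖G.dilation 0 x‖ ≤ 0 * ‖x‖ := G.norm_dilation_le le_rfl zero_le_one x
    obtain ⟨r, hr, hr1⟩ := intermediate_value_Icc (zero_le_one' ℝ)
      (G.continuous_dilation x).norm.continuousOn (show (1 : ℝ) ∈ Icc _ _ from
        ⟨by linarith, by rw [G.dilation_one]; exact h.le⟩)
    beta_reduce at hr1
    have hr0 : 0 < r := by
      refine lt_of_le_of_ne hr.1 ?_
      rintro rfl
      linarith
    have := hsphere _ hr1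
    rw [hd.zero_dilation hr0] at this
    have := mul_le_of_le_one_left (hd.nonneg 0 x) hr.2
    linarith
  set q : ℝ := max 1 (2 * |K| / c) with hq
  have hq1 : 1 ≤ q := le_max_left _ _
  have hq0 : 0 < q := by linarith
  refine ⟨q ^ s, by positivity, fun x hx => ?_⟩
  rw [← G.dilation_dilation_inv hq0.ne' x]
  refine (G.norm_dilation_le_pow hq1 _).trans (mul_le_of_le_one_right (by positivity) (hball _ ?_))
  rw [hd.zero_dilation (by positivity), inv_mul_eq_div, div_lt_iff₀ hq0]
  have h2 : 2 * |K| ≤ c * q := by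
    have := le_max_right 1 (2 * |K| / c)
    rwa [div_le_iff₀ hc, ← hq, mul_comm q] at this
  have h3 : 0 < c * q := by positivity
  have := le_abs_self K
  by_cases hK : |K| = 0
  · linarith
  · have := (abs_nonneg K).lt_of_ne' hK
    linarith

/-! ### Stability of horizontal curves -/

/-- A curve in a fixed ball whose left logarithmic derivative `b` stays within `ε` of a constant
vector `v` ends at group distance `O(ε)` from the end `v` of the one-parameter subgroup with
velocity `v`. -/
theorem exists_norm_neg_mul_le (G : CarnotGroup N s) {R : ℝ} (hR : 0 < R) :
    ∃ M, 0 ≤ M ∧ ∀ (y b : ℝ → Coord N) (v : Coord N) (ε : ℝ),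
      (∀ t ∈ Icc (0 : ℝ) 1, HasDerivWithinAt y (G.frame (y t) (b t)) (Icc 0 1) t) →
      y 0 = 0 → ‖v‖ ≤ R → (∀ t ∈ Icc (0 : ℝ) 1, ‖y t‖ ≤ R) →
      (∀ t ∈ Icc (0 : ℝ) 1, ‖b t - v‖ ≤ ε) → ‖G.mul (-v) (y 1)‖ ≤ M * ε := by
  set B := Metric.closedBall (0 : Coord N) R
  have hmemB : ∀ x, x ∈ B ↔ ‖x‖ ≤ R := fun x => by simp [B]
  have hB : IsCompact B := isCompact_closedBall 0 R
  have hBc : Convex ℝ B := convex_closedBall 0 R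
  obtain ⟨K, hK⟩ := G.contDiff_frame.contDiffOn.exists_lipschitzOnWith (by simp) hBc hB
  obtain ⟨A, hA⟩ := hB.exists_bound_of_continuousOn G.contDiff_frame.continuous.continuousOn
  obtain ⟨L, hL⟩ := G.smooth_mul.contDiffOn.exists_lipschitzOnWith (by simp)
    (hBc.prod hBc) (hB.prod hB)
  set κ : NNReal := K * ⟨R, hR.le⟩ + 1 with hκ
  have hA0 : 0 ≤ A := (norm_nonneg _).trans (hA 0 ((hmemB 0).2 (by simpa using hR.le)))
  have hκ0 : 0 < (κ : ℝ) := by positivity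
  have hexp : 0 ≤ Real.exp κ - 1 := by linarith [Real.add_one_le_exp (κ : ℝ)]
  refine ⟨L * (A / κ * (Real.exp κ - 1)), by positivity, fun y b v ε hy hy0 hv hyR hb => ?_⟩
  have hsub : Ico (0 : ℝ) 1 ⊆ Icc 0 1 := Ico_subset_Icc_self
  have hgr := dist_le_of_approx_trajectories_ODE_of_mem (v := fun _ x => G.frame x v)
    (s := fun _ => B) (K := κ) (a := 0) (b := 1) (f := y) (f' := fun t => G.frame (y t) (b t))
    (g := fun t => t • v) (g' := fun t => G.frame (t • v) v) (εf := A * ε) (εg := 0) (δ := 0)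
    (fun t _ => LipschitzOnWith.of_dist_le_mul fun x hx z hz => by
      rw [dist_eq_norm, ← sub_apply]
      have h1 := hK.dist_le_mul x hx z hz
      rw [dist_eq_norm] at h1
      calc _ ≤ ‖G.frame x - G.frame z‖ * ‖v‖ := ContinuousLinearMap.le_opNorm _ _
        _ ≤ (K * dist x z) * R := by gcongr
        _ ≤ κ * dist x z := by
          rw [hκ]; push_cast
          have : 0 ≤ dist x z := dist_nonneg
          change _ ≤ (K * R + 1) * dist x z
          nlinarith)
    (fun t ht => (hy t ht).continuousWithinAt)
    (fun t ht => (hy t (hsub ht)).mono_of_mem_nhdsWithin (Icc_mem_nhdsGE_of_mem ht))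
    (fun t ht => by
      rw [dist_eq_norm, ← map_sub]
      refine (ContinuousLinearMap.le_opNorm _ _).trans ?_
      gcongr
      · exact hA _ ((hmemB _).2 (hyR t (hsub ht)))
      · exact hb t (hsub ht))
    (fun t ht => (hmemB _).2 (hyR t (hsub ht)))
    (by fun_prop)
    (fun t _ => by
      have := (G.hasDerivAt_mul_smul 0 v t).hasDerivWithinAt (s := Ici t)
      simpa only [G.zero_mul] using this)
    (fun t _ => by simp)
    (fun t ht => by
      rw [hmemB, norm_smul, Real.norm_eq_abs, abs_of_nonneg ht.1]
      exact (mul_le_of_le_one_left (norm_nonneg _) ht.2.le).trans hv)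
    (by simp [hy0]) 1 (by simp)
  rw [gronwallBound_of_K_ne_0 hκ0.ne'] at hgr
  simp only [one_smul, sub_zero, mul_one, add_zero, MulZeroClass.zero_mul, zero_add] at hgr
  have h1 := hL.dist_le_mul (-v, y 1)
    ⟨(hmemB _).2 (by simpa using hv), (hmemB _).2 (hyR 1 (by simp))⟩
    (-v, v) ⟨(hmemB _).2 (by simpa using hv), (hmemB _).2 hv⟩
  simp only [G.neg_mul_self, dist_zero_right] at h1
  refine h1.trans ?_
  rw [dist_prod_same_left, _root_.mul_assoc]
  gcongr
  refine hgr.trans_eq ?_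
  ring

/-! ### Lipschitz curves of class `C^{1,α}` -/

theorem norm_le_sum_abs (x : Coord N) : ‖x‖ ≤ ∑ j, |x j| := by
  conv_lhs => rw [← sum_smul_single x]
  refine (norm_sum_le _ _).trans (Finset.sum_le_sum fun j _ => ?_)
  simp [norm_smul]

theorem horizontalVelocity_mem (γ : ℝ → Coord N) (t : ℝ) :
    G.horizontalVelocity 0 1 γ t ∈ degreeLayer G.deg 1 :=
  G.mem_degreeLayer_one_of fun j hj => by simp [horizontalVelocity, hj]

theorem exists_horizontalVelocity_holder {α : ℝ} {γ : ℝ → Coord N}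
    (hγ : IsC1HolderCurve α 0 1 γ) :
    ∃ A, 0 ≤ A ∧ ∀ t ∈ Icc (0 : ℝ) 1, ∀ r ∈ Icc (0 : ℝ) 1,
      ‖G.horizontalVelocity 0 1 γ t - G.horizontalVelocity 0 1 γ r‖ ≤ A * |t - r| ^ α := by
  choose C hC using fun j => (hγ j).2
  refine ⟨∑ j, |C j|, by positivity, fun t ht r hr => (norm_le_sum_abs _).trans ?_⟩
  rw [Finset.sum_mul]
  refine Finset.sum_le_sum fun j _ => ?_
  by_cases hj : G.deg j = 1
  · have h1 := hC j t ht r hr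
    simp only [horizontalVelocity, PiLp.sub_apply, hj, if_true]
    exact h1.trans (by gcongr; exact le_abs_self _)
  · simp only [horizontalVelocity, PiLp.sub_apply, hj, if_false, sub_self, abs_zero]
    positivity

/-- On the scale `h ≥ |r - t|` the increment `γ(t)⁻¹ * γ(r)` of a Lipschitz curve stays in a fixed
Euclidean ball. Equivalently, its `j`-th coordinate is `O(h ^ deg j)`. -/
theorem exists_norm_dilation_neg_mul_le (hd : G.IsHomogeneousMetric d) {γ : ℝ → Coord N}
    (hlip : IsLipschitzCurve d 0 1 γ) :
    ∃ R, 0 < R ∧ ∀ t ∈ Icc (0 : ℝ) 1, ∀ r ∈ Icc (0 : ℝ) 1, ∀ h : ℝ, 0 < h → |r - t| ≤ h →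
      ‖G.dilation h⁻¹ (G.mul (-γ t) (γ r))‖ ≤ R := by
  obtain ⟨K, hK⟩ := hlip
  obtain ⟨R, hR, hRb⟩ := hd.exists_norm_le |K|
  refine ⟨R, hR, fun t ht r hr h h0 hh => hRb _ ?_⟩
  rw [hd.zero_dilation (inv_pos.2 h0), inv_mul_le_iff₀ h0, ← hd.eq_zero_neg_mul]
  refine (hK t ht r hr).trans ?_
  rw [abs_sub_comm, mul_comm h]
  gcongr
  exact le_abs_self K

/-- The left logarithmic derivative of a differentiable Lipschitz curve is its horizontal velocity:
the coordinates of `γ(t)⁻¹ * γ(r)` of degree at least two are `O(|r - t| ^ 2)`. -/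
theorem hasDerivWithinAt_neg_mul (hd : G.IsHomogeneousMetric d) {γ : ℝ → Coord N}
    (hγ : ∀ j, DifferentiableOn ℝ (fun t => γ t j) (Icc 0 1)) (hlip : IsLipschitzCurve d 0 1 γ)
    {t : ℝ} (ht : t ∈ Icc (0 : ℝ) 1) :
    HasDerivWithinAt (fun r => G.mul (-γ t) (γ r)) (G.horizontalVelocity 0 1 γ t) (Icc 0 1) t := by
  obtain ⟨R, hR, hbd⟩ := exists_norm_dilation_neg_mul_le hd hlip
  rw [hasDerivWithinAt_iff_forall_coord]
  intro j
  have hj0 := G.one_le_deg j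
  by_cases hj : G.deg j = 1
  · simp only [horizontalVelocity, G.mul_apply_of_deg_eq_one hj, hj, if_true]
    exact (hγ j t ht).hasDerivWithinAt.const_add _
  · simp only [horizontalVelocity, hj, if_false]
    have hquad : ∀ r ∈ Icc (0 : ℝ) 1, |G.mul (-γ t) (γ r) j| ≤ R * |r - t| ^ 2 := by
      intro r hr
      rcases eq_or_ne r t with rfl | hrt
      · simp [G.neg_mul_self]
      have h0 : 0 < |r - t| := abs_pos.2 (sub_ne_zero.2 hrt)
      have h1 : |r - t| ≤ 1 := abs_sub_le_iff.2 ⟨by linarith [ht.1, hr.2], by linarith [ht.2, hr.1]⟩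
      have h2 := (PiLp.norm_apply_le (G.dilation |r - t|⁻¹ (G.mul (-γ t) (γ r))) j).trans
        (hbd t ht r hr _ h0 le_rfl)
      rw [G.dilation_apply, Real.norm_eq_abs, abs_mul, inv_pow, abs_inv, abs_pow, abs_abs,
        inv_mul_le_iff₀ (by positivity), mul_comm] at h2
      refine h2.trans ?_
      gcongr R * ?_
      exact pow_le_pow_of_le_one h0.le h1 (by omega)
    rw [hasDerivWithinAt_iff_isLittleO]
    simp only [G.neg_mul_self, PiLp.zero_apply, smul_zero, sub_zero]
    have hO : (fun r => G.mul (-γ t) (γ r) j) =O[𝓝[Icc 0 1] t] fun r => (r - t) ^ 2 :=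
      Asymptotics.IsBigO.of_bound R (by
        filter_upwards [self_mem_nhdsWithin] with r hr
        simpa using hquad r hr)
    refine hO.trans_isLittleO ?_
    have hlim : Tendsto (fun r => r - t) (𝓝[Icc 0 1] t) (𝓝 0) := by
      have : Continuous (fun r : ℝ => r - t) := by fun_prop
      simpa using (this.tendsto t).mono_left nhdsWithin_le_nhds
    exact (Asymptotics.isLittleO_pow_id one_lt_two).comp_tendsto hlim

/-- The rescaled curve `τ ↦ δ_h (γ(t)⁻¹ * γ(t + τ e))` has left logarithmic derivative
`h e a(t + τ e)`, where `a` is the horizontal velocity of `γ`: the dilation acts on `V_1` as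
multiplication by `h`. -/
theorem hasDerivWithinAt_dilation_neg_mul (hd : G.IsHomogeneousMetric d) {γ : ℝ → Coord N}
    (hγ : ∀ j, DifferentiableOn ℝ (fun t => γ t j) (Icc 0 1)) (hlip : IsLipschitzCurve d 0 1 γ)
    {t e : ℝ} (ht : t ∈ Icc (0 : ℝ) 1) (hte : t + e ∈ Icc (0 : ℝ) 1) {τ : ℝ}
    (hτ : τ ∈ Icc (0 : ℝ) 1) (h : ℝ) :
    HasDerivWithinAt (fun τ => G.dilation h (G.mul (-γ t) (γ (t + τ * e))))
      (G.frame (G.dilation h (G.mul (-γ t) (γ (t + τ * e))))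
        ((h * e) • G.horizontalVelocity 0 1 γ (t + τ * e))) (Icc 0 1) τ := by
  have hmaps : MapsTo (fun τ => t + τ * e) (Icc 0 1) (Icc (0 : ℝ) 1) := by
    intro τ hτ
    have := (convex_Icc (0 : ℝ) 1).add_smul_mem ht hte hτ
    simpa using this
  have h1 := hasDerivWithinAt_neg_mul hd hγ hlip (hmaps hτ)
  have h2 : HasDerivWithinAt (fun τ => t + τ * e) e (Icc 0 1) τ := by
    simpa using ((hasDerivWithinAt_id τ (Icc 0 1)).mul_const e).const_add t
  have h3 := HasDerivWithinAt.scomp (h := fun τ => t + τ * e) τ h1 h2 hmaps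
  have h4 := (G.dilationCLM h).hasFDerivAt.comp_hasDerivWithinAt τ h3
  have h5 := G.hasDerivWithinAt_mul_left (G.dilation h (G.mul (-γ t) (γ (t + τ * e)))) h4
    (by simp [G.neg_mul_self, G.dilation_zero])
  rw [dilationCLM_apply, G.dilation_smul, G.dilation_of_mem (horizontalVelocity_mem γ _), pow_one,
    smul_smul, mul_comm e] at h5
  refine h5.congr_of_eventuallyEq (Eventually.of_forall fun r => ?_) ?_
  all_goals
    simp only [Function.comp_def, dilationCLM_apply, ← G.dilation_mul, G.mul_assoc,
      G.mul_neg_cancel_left]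

end CarnotGroup

theorem proposition3p2 {N s : ℕ} (G : CarnotGroup N s)
    (d : Coord N → Coord N → ℝ) (hd : G.IsHomogeneousMetric d)
    (α : ℝ) (hα0 : 0 < α) (hα1 : α ≤ 1)
    (γ : ℝ → Coord N) (hγ : IsC1HolderCurve α 0 1 γ) (hlip : IsLipschitzCurve d 0 1 γ) :
    ∃ C : ℝ, 0 < C ∧ ∀ t₀ ∈ Set.Icc (0 : ℝ) 1, ∀ t ∈ Set.Icc (0 : ℝ) 1,
      d (γ t) (G.tangentLine 0 1 γ t₀ t) ≤ C * |t - t₀| ^ (1 + α / (s : ℝ)) := by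
  obtain ⟨A, hA0, hA⟩ := CarnotGroup.exists_horizontalVelocity_holder (G := G) hγ
  obtain ⟨R, hR, hbd⟩ := CarnotGroup.exists_norm_dilation_neg_mul_le hd hlip
  set a := G.horizontalVelocity 0 1 γ with ha
  obtain ⟨M, hM0, hM⟩ := G.exists_norm_neg_mul_le (R := R + (‖a 0‖ + A)) (by positivity)
  obtain ⟨B, hB0, hB⟩ := hd.exists_le_rpow (R := M * A + 1) (by positivity)
  refine ⟨B * (M * A) ^ (1 / (s : ℝ)) + 1, by positivity, fun t₀ ht₀ t ht => ?_⟩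
  obtain ⟨e, rfl⟩ : ∃ e, t = t₀ + e := ⟨t - t₀, by ring⟩
  simp only [CarnotGroup.tangentLine, add_sub_cancel_left, ← ha]
  rcases eq_or_ne e 0 with rfl | he
  · rw [add_zero, zero_smul, G.mul_zero, (hd.eq_zero_iff _ _).2 rfl]
    positivity
  have h0 : 0 < |e| := abs_pos.2 he
  have h1 : |e| ≤ 1 := abs_le.2 ⟨by linarith [ht₀.2, ht.1], by linarith [ht₀.1, ht.2]⟩
  have hsign : |(|e|⁻¹ * e)| = 1 := by rw [abs_mul, abs_inv, abs_abs, inv_mul_cancel₀ h0.ne']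
  have hmem : ∀ τ ∈ Icc (0 : ℝ) 1, t₀ + τ * e ∈ Icc (0 : ℝ) 1 := fun τ hτ => by
    simpa using (convex_Icc (0 : ℝ) 1).add_smul_mem ht₀ ht hτ
  have hscale : ∀ τ ∈ Icc (0 : ℝ) 1, |τ * e| ≤ |e| := fun τ hτ => by
    rw [abs_mul, abs_of_nonneg hτ.1]
    exact mul_le_of_le_one_left h0.le hτ.2
  have ha_bd : ‖a t₀‖ ≤ ‖a 0‖ + A := by
    have h2 := hA t₀ ht₀ 0 (by simp)
    have h3 : |t₀ - 0| ^ α ≤ 1 :=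
      Real.rpow_le_one (abs_nonneg _) (by rw [sub_zero, abs_of_nonneg ht₀.1]; exact ht₀.2) hα0.le
    have h4 := norm_le_norm_add_norm_sub' (a t₀) (a 0)
    have h5 := mul_le_of_le_one_right hA0 h3
    linarith
  -- The factor `e / |e|` is the sign of `e`; it covers both sides of `t₀` at once.
  set v := (|e|⁻¹ * e) • a t₀ with hv
  set z := G.mul (-v) (G.dilation |e|⁻¹ (G.mul (-γ t₀) (γ (t₀ + e)))) with hz
  have hz_bd : ‖z‖ ≤ M * (A * |e| ^ α) := by
    have := hM (fun τ => G.dilation |e|⁻¹ (G.mul (-γ t₀) (γ (t₀ + τ * e))))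
      (fun τ => (|e|⁻¹ * e) • a (t₀ + τ * e)) v (A * |e| ^ α)
      (fun τ hτ => CarnotGroup.hasDerivWithinAt_dilation_neg_mul hd (fun j => (hγ j).1) hlip ht₀ ht
        hτ _)
      (by simp [G.neg_mul_self, G.dilation_zero])
      (by rw [hv, norm_smul, Real.norm_eq_abs, hsign, one_mul]; linarith)
      (fun τ hτ => (hbd t₀ ht₀ _ (hmem τ hτ) _ h0 (by simpa using hscale τ hτ)).trans
        (by linarith [norm_nonneg (a 0)]))
      (fun τ hτ => by
        rw [hv, ← smul_sub, norm_smul, Real.norm_eq_abs, hsign, one_mul]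
        refine (hA _ (hmem τ hτ) _ ht₀).trans ?_
        rw [add_sub_cancel_left]
        exact mul_le_mul_of_nonneg_left
          (Real.rpow_le_rpow (abs_nonneg _) (hscale τ hτ) hα0.le) hA0)
    simpa only [one_mul] using this
  have hz_le : ‖z‖ ≤ M * A + 1 := by
    have : M * (A * |e| ^ α) ≤ M * (A * 1) := by
      gcongr
      exact Real.rpow_le_one h0.le h1 hα0.le
    linarith
  have hdz : d (γ (t₀ + e)) (G.mul (γ t₀) (e • a t₀)) = |e| * d 0 z := by
    rw [hd.symm, hd.eq_zero_neg_mul, G.neg_mul_rev, G.mul_assoc, ← hd.zero_dilation h0, hz,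
      G.dilation_mul, G.dilation_dilation_inv h0.ne', G.dilation_neg, hv, G.dilation_smul,
      G.dilation_of_mem (CarnotGroup.horizontalVelocity_mem γ t₀), pow_one, smul_smul, ← ha,
      mul_right_comm, inv_mul_cancel₀ h0.ne', one_mul]
  have hs : (0 : ℝ) ≤ 1 / s := by positivity
  rw [hdz]
  calc |e| * d 0 z ≤ |e| * (B * (M * (A * |e| ^ α)) ^ (1 / (s : ℝ))) := by
        gcongr
        exact (hB z hz_le).trans (by gcongr)
    _ = B * (M * A) ^ (1 / (s : ℝ)) * |e| ^ (1 + α / (s : ℝ)) := by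
        rw [← mul_assoc M, Real.mul_rpow (by positivity) (by positivity), ← Real.rpow_mul h0.le,
          Real.rpow_add h0, Real.rpow_one, mul_one_div]
        ring
    _ ≤ _ := by gcongr; linarith
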